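/- Let $A,B$ be $n\times n$ complex Hermitian matrices. Write $n_+(A)$, $n_-(A)$ for the numbers of positive and negative eigenvalues of $A$ (with multiplicity), and likewise for $B$. For the pencil $A-zB$ put $A-\infty B:=B$ and let $r=\max_{z\in\mathbb C\cup\{\infty\}}\operatorname{rank}(A-zB)$; a point $\lambda\in\mathbb C\cup\{\infty\}$ is an eigenvalue of $(A,B)$ if $\operatorname{rank}(A-\lambda B)<r$ (the pencil may be singular, i.e. $r<n$). The algebraic multiplicity of a real eigenvalue $\lambda$ is the sum of the orders of vanishing at $t=\lambda$ of those real-analytic eigenvalue functions $\lambda_i(t)$ of $A-tB$ $(t\in\mathbb R)$ that are not identically zero; equivalently, it is the multiplicity of $\lambda$ as a zero of the polynomial in $t$ that is the lowest not identically vanishing coefficient, in powers of $x$, of $\det(xI-(A-tB))$. (If the pencil is regular, this is the multiplicity of $\lambda$ as a zero of $\det(A-tB)$.) Let $n_+(A,B)$, $n_-(A,B)$, $n_{\mathbb R}(A,B)$ be the numbers of positive, negative, and finite real eigenvalues of $(A,B)$, respectively, counted with algebraic multiplicity. Let $k\ge 0$ be an integer. Suppose that $B$ has exactly $n-k$ positive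 eigenvalues, $n_+(B)=n-k$, and that $n-k\ge |n_-(A)-n_+(A)|$. Then \[ \begin{aligned} n_+(A)-k&\le n_+(A,B)\le n_+(A)+k,\\ n_-(A)-k&\le n_-(A,B)\le n_-(A)+k,\\ n-2k&\le n_{\mathbb R}(A,B)\le n. \end{aligned} \] -/

import Mathlib

open scoped Matrix

noncomputable section

namespace HermitianPencil

variable {n : ℕ}

/-- `n₊(A)`: the number of positive eigenvalues of a Hermitian matrix, with multiplicity. -/
def nPos {A : Matrix (Fin n) (Fin n) ℂ} (hA : A.IsHermitian) : ℕ :=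
  (Finset.univ.filter fun i => 0 < hA.eigenvalues i).card

/-- `n₋(A)`: the number of negative eigenvalues of a Hermitian matrix, with multiplicity. -/
def nNeg {A : Matrix (Fin n) (Fin n) ℂ} (hA : A.IsHermitian) : ℕ :=
  (Finset.univ.filter fun i => hA.eigenvalues i < 0).card

/-- The value `A - z B` of the pencil at `z ∈ ℂ ∪ {∞}`, where `A - ∞ B := B`. -/
def pencilAt (A B : Matrix (Fin n) (Fin n) ℂ) : OnePoint ℂ → Matrix (Fin n) (Fin n) ℂ
  | none => B
  | some z => A - z • B

/-- The normal rank `r` of the pencil: the largest rank of `A - z B` over `z ∈ ℂ ∪ {∞}`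
(a supremum of natural numbers bounded by `n`). -/
def normalRank (A B : Matrix (Fin n) (Fin n) ℂ) : ℕ :=
  ⨆ z : OnePoint ℂ, (pencilAt A B z).rank

/-- `z ∈ ℂ ∪ {∞}` is an eigenvalue of the pencil (possibly singular) if the rank drops at `z`. -/
def IsEigenvalue (A B : Matrix (Fin n) (Fin n) ℂ) (z : OnePoint ℂ) : Prop :=
  (pencilAt A B z).rank < normalRank A B

/-- The pencil `A - t B` as a matrix of polynomials in the indeterminate `t`. -/
def polyPencil (A B : Matrix (Fin n) (Fin n) ℂ) : Matrix (Fin n) (Fin n) (Polynomial ℂ) :=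
  A.map Polynomial.C - (Polynomial.X : Polynomial ℂ) • B.map Polynomial.C

/-- The product, up to sign, of those eigenvalue functions of `t ↦ A - t B` that are not
identically zero. If `λ₁(t), …, λₙ(t)` are the eigenvalues of `A - t B`, then
`det (x I - (A - t B)) = ∏ i, (x - λᵢ(t))`, so this product is, up to sign, the lowest
coefficient, in powers of `x`, that is not the zero polynomial in `t`. For a regular pencil
it is `± det (A - t B)`. -/
def eigenfunctionProd (A B : Matrix (Fin n) (Fin n) ℂ) : Polynomial ℂ :=
  (polyPencil A B).charpoly.trailingCoeff

/-- The algebraic multiplicity of the real number `μ` for the Hermitian pencil `A - t B`: the sum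
of the multiplicities of `μ` as a zero of the eigenvalue functions of `t ↦ A - t B` that are not
identically zero, that is, the multiplicity of `μ` as a zero of their product. The agreement with
the sum over any analytic enumeration of the eigenvalues is `algMult_eq_sum_order` below. -/
def algMult (A B : Matrix (Fin n) (Fin n) ℂ) (μ : ℝ) : ℕ :=
  (eigenfunctionProd A B).rootMultiplicity (μ : ℂ)

open scoped Classical in
/-- The number of finite real eigenvalues of the pencil in `S ⊆ ℝ`, with algebraic multiplicity.
(The sum has finite support, since a polynomial has finitely many roots.) -/
def countIn (A B : Matrix (Fin n) (Fin n) ℂ) (S : Set ℝ) : ℕ :=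
  ∑ᶠ μ : ℝ, if μ ∈ S ∧ IsEigenvalue A B (((μ : ℝ) : ℂ) : OnePoint ℂ) then algMult A B μ else 0

/-- `n₊(A, B)`: the number of positive eigenvalues of the pencil. -/
def pencilPos (A B : Matrix (Fin n) (Fin n) ℂ) : ℕ := countIn A B (Set.Ioi 0)

/-- `n₋(A, B)`: the number of negative eigenvalues of the pencil. -/
def pencilNeg (A B : Matrix (Fin n) (Fin n) ℂ) : ℕ := countIn A B (Set.Iio 0)

/-- `n_R(A, B)`: the number of finite real eigenvalues of the pencil. -/
def pencilReal (A B : Matrix (Fin n) (Fin n) ℂ) : ℕ := countIn A B Set.univ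

theorem eval_coeff_charpoly (A B : Matrix (Fin n) (Fin n) ℂ) (z : ℂ) (j : ℕ) :
    ((polyPencil A B).charpoly.coeff j).eval z = (A - z • B).charpoly.coeff j := by
  have h : (polyPencil A B).map (Polynomial.evalRingHom z) = A - z • B := by
    ext i j
    simp [polyPencil]
    exact mul_comm _ _
  rw [← h, Matrix.charpoly_map, Polynomial.coeff_map, Polynomial.coe_evalRingHom]

open scoped Classical in
/-- Whenever the eigenvalues of `A - t B`, `t ∈ ℝ`, are enumerated by real-analytic functions
`lam i`, the number `algMult A B μ` is the sum of the orders of vanishing at `μ` of those `lam i`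
that are not identically zero. -/
theorem algMult_eq_sum_order (A B : Matrix (Fin n) (Fin n) ℂ) (lam : Fin n → ℝ → ℝ)
    (han : ∀ i, AnalyticOnNhd ℝ (lam i) Set.univ)
    (hlam : ∀ t : ℝ, (A - (t : ℂ) • B).charpoly =
      ∏ i, (Polynomial.X - Polynomial.C ((lam i t : ℝ) : ℂ)))
    (μ : ℝ) :
    (algMult A B μ : ℕ∞) =
      ∑ i ∈ Finset.univ.filter (fun i => lam i ≠ 0), analyticOrderAt (lam i) μ := by
  set N := Finset.univ.filter (fun i => lam i ≠ 0) with hN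
  set Z := Finset.univ.filter (fun i => ¬ lam i ≠ 0) with hZ
  let g : ℝ → ℝ := fun t => ∏ i ∈ N, (- lam i t)
  have hsplit : ∀ t : ℝ, (A - (t : ℂ) • B).charpoly =
      (∏ i ∈ N, (Polynomial.X - Polynomial.C ((lam i t : ℝ) : ℂ))) * Polynomial.X ^ Z.card := by
    intro t
    rw [hlam t, ← Finset.prod_filter_mul_prod_filter_not Finset.univ (fun i => lam i ≠ 0)]
    congr 1
    rw [← Finset.prod_const]
    refine Finset.prod_congr rfl fun i hi => ?_
    have : lam i = 0 := by simpa [hZ] using hi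
    simp [this]
  have hlow : ∀ j < Z.card, (polyPencil A B).charpoly.coeff j = 0 := by
    intro j hj
    refine Polynomial.eq_zero_of_infinite_isRoot _ ?_
    refine (Set.infinite_range_of_injective Complex.ofReal_injective).mono ?_
    rintro _ ⟨t, rfl⟩
    change Polynomial.eval _ _ = 0
    rw [eval_coeff_charpoly, hsplit, Polynomial.coeff_mul_X_pow', if_neg (by omega)]
  have hval : ∀ t : ℝ, ((polyPencil A B).charpoly.coeff Z.card).eval (t : ℂ) = (g t : ℂ) := by
    intro t
    rw [eval_coeff_charpoly, hsplit, Polynomial.coeff_mul_X_pow', if_pos le_rfl, Nat.sub_self,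
      Polynomial.coeff_zero_eq_eval_zero, Polynomial.eval_prod]
    simp [g]
  have hfin : ∀ i ∈ N, ∀ x, analyticOrderAt (lam i) x ≠ ⊤ := by
    intro i hi x hx
    rw [analyticOrderAt_eq_top] at hx
    have : lam i = 0 := by
      funext y
      exact (han i).eqOn_zero_of_preconnected_of_eventuallyEq_zero isPreconnected_univ
        (Set.mem_univ x) hx (Set.mem_univ y)
    simp [hN] at hi
    exact hi this
  have hord : ∀ S : Finset (Fin n), AnalyticAt ℝ (fun t => ∏ i ∈ S, (- lam i t)) μ ∧
      analyticOrderAt (fun t => ∏ i ∈ S, (- lam i t)) μ = ∑ i ∈ S, analyticOrderAt (lam i) μ := by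
    intro S
    induction S using Finset.induction_on with
    | empty =>
      refine ⟨by simpa using analyticAt_const, ?_⟩
      simp only [Finset.prod_empty, Finset.sum_empty]
      exact (analyticAt_const.analyticOrderAt_eq_zero).2 one_ne_zero
    | insert a S ha ih =>
      have h1 : AnalyticAt ℝ (-lam a) μ := (han a μ (Set.mem_univ _)).neg
      have e : (fun t => ∏ i ∈ insert a S, (- lam i t)) =
          (-lam a) * (fun t => ∏ i ∈ S, (- lam i t)) := by
        funext t
        simp [Finset.prod_insert ha]
      rw [e, Finset.sum_insert ha]
      refine ⟨h1.mul ih.1, ?_⟩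
      rw [analyticOrderAt_mul h1 ih.1, ih.2, analyticOrderAt_neg]
  obtain ⟨hg, hgo⟩ := hord N
  change AnalyticAt ℝ g μ at hg
  change analyticOrderAt g μ = _ at hgo
  have hgt : analyticOrderAt g μ ≠ ⊤ := by
    rw [hgo]
    exact (ENat.sum_ne_top).2 fun i hi => hfin i hi μ
  set c := (polyPencil A B).charpoly.coeff Z.card with hc
  have hc0 : c ≠ 0 := by
    intro h
    apply hgt
    rw [analyticOrderAt_eq_top]
    refine Filter.Eventually.of_forall fun t => ?_
    have := hval t
    rw [h] at this
    simpa using this.symm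
  have htr : eigenfunctionProd A B = c := by
    have hd : (polyPencil A B).charpoly.natTrailingDegree = Z.card := by
      apply le_antisymm
      · exact Polynomial.natTrailingDegree_le_of_ne_zero hc0
      · refine Polynomial.le_natTrailingDegree ?_ hlow
        intro h
        apply hc0
        rw [hc, h, Polynomial.coeff_zero]
    rw [eigenfunctionProd, Polynomial.trailingCoeff, hd]
  rw [← hgo, algMult, htr]
  obtain ⟨k, hk⟩ := ENat.ne_top_iff_exists.1 hgt
  rw [← hk]
  obtain ⟨g1, hg1, hg1n, hgg⟩ := (hg.analyticOrderAt_eq_natCast).1 hk.symm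
  let h : ℝ → ℂ := fun t => c.eval (t : ℂ)
  have hoR : ∀ x : ℝ, AnalyticAt ℝ (fun t : ℝ => (t : ℂ)) x := fun x =>
    Complex.ofRealCLM.analyticAt x
  have hpa : ∀ q : Polynomial ℂ, AnalyticAt ℝ (fun t : ℝ => q.eval (t : ℂ)) μ := by
    intro q
    have h1 : AnalyticAt ℂ (fun z : ℂ => q.eval z) (μ : ℂ) := by
      simpa using AnalyticAt.aeval_polynomial (analyticAt_id (𝕜 := ℂ) (z := (μ : ℂ))) q
    exact (h1.restrictScalars (𝕜 := ℝ)).comp (hoR μ)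
  have e1 : analyticOrderAt h μ = (k : ℕ∞) := by
    refine ((hpa c).analyticOrderAt_eq_natCast).2 ⟨fun t => (g1 t : ℂ), ?_, by simpa using hg1n, ?_⟩
    · exact (Complex.ofRealCLM.analyticAt (g1 μ)).comp hg1
    · filter_upwards [hgg] with t ht
      simp only [hval t, ht]
      simp
  have e2 : analyticOrderAt h μ = ((c.rootMultiplicity (μ : ℂ) : ℕ) : ℕ∞) := by
    obtain ⟨q, hq, hqn⟩ := Polynomial.exists_eq_pow_rootMultiplicity_mul_and_not_dvd c hc0 (μ : ℂ)
    refine ((hpa c).analyticOrderAt_eq_natCast).2 ⟨fun t => q.eval (t : ℂ), hpa q, ?_, ?_⟩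
    · intro h0
      exact hqn (Polynomial.dvd_iff_isRoot.2 h0)
    · refine Filter.Eventually.of_forall fun t => ?_
      conv_lhs => rw [hq]
      simp
  rw [← e1, e2]

end HermitianPencil

end

/-
The functions `n₊(A - t B)` and `n₋(A - t B)` are lower semicontinuous in `t`, and their sum is the
rank, which generically equals `n - d`, with `d` the number of identically vanishing eigenvalue
functions, and drops at `t₀` by at most the algebraic multiplicity of `t₀`. So either count jumps
at `t₀` by at most that multiplicity, and `n₊(A - t B)` plus the number of eigenvalues in `(-∞, t]`
is monotone; likewise `n₋(A - t B)` plus the number of eigenvalues in `[t, ∞)` is antitone.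
Comparing `t = 0` with `t = ±T` for large `T`, where `A - t B = -t (B - t⁻¹ A)` has at least
`n₊(B)` eigenvalues of the sign of `-t`, gives the lower bounds. The upper bounds follow from them,
because the product of the nonzero eigenvalue functions has degree at most `n - d` in `t`.
-/

namespace HermitianPencil

variable {n : ℕ}

section Determinants

variable {ι R K : Type*} [Fintype ι] [DecidableEq ι] [CommRing R] [Field K]

theorem prod_dvd_det {M : Matrix ι ι R} {v : ι → R} (h : ∀ i j, v j ∣ M i j) :
    ∏ j, v j ∣ M.det := by
  rw [Matrix.det_apply']
  exact Finset.dvd_sum fun σ _ =>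
    (Finset.prod_dvd_prod_of_dvd _ _ fun j _ => h (σ j) j).mul_left _

theorem pow_dvd_det_diagonal_add_smul (s : R) (D : ι → R) (N : Matrix ι ι R) (Z : Finset ι)
    (hZ : ∀ i ∈ Z, D i = 0) : s ^ Z.card ∣ (Matrix.diagonal D + s • N).det := by
  have h : ∏ j, (if j ∈ Z then s else 1) ∣ (Matrix.diagonal D + s • N).det := by
    refine prod_dvd_det fun i j => ?_
    split_ifs with hj
    · rcases eq_or_ne i j with rfl | hij
      · simp [hZ i hj]
      · simp [hij]
    · exact one_dvd _
  simpa using h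

theorem pow_dvd_det_map_add_smul (f : K →+* R) (M : Matrix ι ι K) (s : R) (N : Matrix ι ι R) :
    s ^ (Fintype.card ι - M.rank) ∣ (M.map f + s • N).det := by
  classical
  obtain ⟨L, L', D, hM⟩ :=
    Matrix.Pivot.exists_list_transvec_mul_diagonal_mul_list_transvec M
  set P := (L.map Matrix.TransvectionStruct.toMatrix).prod
  set Q := (L'.map Matrix.TransvectionStruct.toMatrix).prod
  have hP : P.det = 1 := Matrix.TransvectionStruct.det_toMatrix_prod L
  have hQ : Q.det = 1 := Matrix.TransvectionStruct.det_toMatrix_prod L'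
  have hrank : (Finset.univ.filter fun i => D i = 0).card = Fintype.card ι - M.rank := by
    rw [hM, Matrix.rank_mul_eq_left_of_isUnit_det _ _ (by simp [hQ]),
      Matrix.rank_mul_eq_right_of_isUnit_det _ _ (by simp [hP]), Matrix.rank_diagonal,
      ← Fintype.card_subtype_compl, Fintype.card_subtype]
    simp
  have hfactor : M.map f + s • N = P.map f *
      (Matrix.diagonal (f ∘ D) + s • (P⁻¹.map f * N * Q⁻¹.map f)) * Q.map f := by
    have hPinv : P.map f * P⁻¹.map f = 1 := by
      rw [← Matrix.map_mul, Matrix.mul_nonsing_inv _ (by simp [hP])]; simp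
    have hQinv : Q⁻¹.map f * Q.map f = 1 := by
      rw [← Matrix.map_mul, Matrix.nonsing_inv_mul _ (by simp [hQ])]; simp
    have hN : P.map f * (P⁻¹.map f * N * Q⁻¹.map f) * Q.map f = N := by
      rw [mul_assoc, mul_assoc (P⁻¹.map f * N), hQinv, mul_one, ← mul_assoc, hPinv, one_mul]
    rw [mul_add, add_mul, Matrix.mul_smul, Matrix.smul_mul, hN, hM, Matrix.map_mul,
      Matrix.map_mul, Matrix.diagonal_map (map_zero f)]
    rfl
  rw [hfactor, Matrix.det_mul, Matrix.det_mul, ← hrank]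
  refine ((pow_dvd_det_diagonal_add_smul s _ _ _ fun i hi => ?_).mul_left _).mul_right _
  simp [(Finset.mem_filter.1 hi).2]

theorem pow_dvd_coeff_charpoly_map_add_smul (f : K →+* R) (M : Matrix ι ι K) (s : R)
    (N : Matrix ι ι R) (d : ℕ) :
    s ^ (Fintype.card ι - d - M.rank) ∣ (M.map f + s • N).charpoly.coeff d := by
  rcases le_total (Fintype.card ι) d with hd | hd
  · simp [Nat.sub_eq_zero_of_le hd]
  rw [← Nat.sub_sub_self hd, Matrix.charpoly_coeff_eq_sum_minors _ _ (Nat.sub_le _ _),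
    Nat.sub_sub_self hd]
  refine (Finset.dvd_sum fun S hS => ?_).mul_left _
  have hminor := pow_dvd_det_map_add_smul f (M.submatrix ((↑) : S → ι) (↑)) s (N.submatrix (↑) (↑))
  rw [Fintype.card_coe, (Finset.mem_powersetCard.1 hS).2] at hminor
  exact (pow_dvd_pow s (Nat.sub_le_sub_left (Matrix.rank_submatrix_le M _ _) _)).trans hminor

open Polynomial in
theorem natDegree_coeff_charpoly_le (A B : Matrix ι ι R) (d : ℕ) :
    ((A.map C - (X : R[X]) • B.map C).charpoly.coeff d).natDegree ≤ Fintype.card ι - d := by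
  nontriviality R
  rcases lt_or_ge (Fintype.card ι) d with hd | hd
  · rw [coeff_eq_zero_of_natDegree_lt (by rwa [Matrix.charpoly_natDegree_eq_dim])]
    simp
  rw [← Nat.sub_sub_self hd, Matrix.charpoly_coeff_eq_sum_minors _ _ (Nat.sub_le _ _),
    Nat.sub_sub_self hd, ← C_1, ← C_neg, ← C_pow]
  refine (natDegree_C_mul_le _ _).trans (natDegree_sum_le_of_forall_le _ _ fun S hS => ?_)
  have hminor := natDegree_det_X_add_C_le (-B.submatrix ((↑) : S → ι) (↑))
    (A.submatrix ((↑) : S → ι) (↑))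
  rw [Fintype.card_coe, (Finset.mem_powersetCard.1 hS).2] at hminor
  convert hminor using 3
  ext1 i j
  simp [sub_eq_neg_add]

end Determinants

section LocallyMonotone

open Set Filter Topology

theorem monotone_of_eventually_le {α β : Type*} [ConditionallyCompleteLinearOrder α]
    [DenselyOrdered α] [TopologicalSpace α] [OrderTopology α] [Preorder β] {G : α → β}
    (hleft : ∀ t₀, ∀ᶠ t in 𝓝[<] t₀, G t ≤ G t₀) (hright : ∀ t₀, ∀ᶠ t in 𝓝[>] t₀, G t₀ ≤ G t) :
    Monotone G := by
  intro a b hab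
  let S : Set α := {x | ∀ y ∈ Icc a x, G a ≤ G y}
  suffices Icc a b ⊆ S from this (right_mem_Icc.2 hab) b (right_mem_Icc.2 hab)
  refine IsClosed.Icc_subset_of_forall_mem_nhdsWithin (isClosed_of_closure_subset ?_) ?_ ?_
  · intro x hx
    have hxab : x ∈ Icc a b := closure_minimal inter_subset_right isClosed_Icc hx
    have hlt : ∀ y ∈ Ico a x, G a ≤ G y := fun y hy => by
      obtain ⟨z, hyz, hzS, -⟩ := mem_closure_iff.1 hx (Ioi y) isOpen_Ioi hy.2
      exact hzS y ⟨hy.1, le_of_lt hyz⟩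
    refine ⟨fun y hy => ?_, hxab⟩
    rcases hy.2.lt_or_eq with hyx | rfl
    · exact hlt y ⟨hy.1, hyx⟩
    rcases hy.1.eq_or_lt with rfl | hay
    · exact le_rfl
    have := nhdsLT_neBot_of_exists_lt ⟨a, hay⟩
    obtain ⟨z, hzy, hz⟩ := ((hleft y).and (Ioo_mem_nhdsLT hay)).exists
    exact (hlt z ⟨hz.1.le, hz.2⟩).trans hzy
  · exact fun y hy => (hy.1.antisymm hy.2) ▸ le_rfl
  · rintro x ⟨hxS, hax, hxb⟩
    obtain ⟨u, hxu, hu⟩ := (mem_nhdsGT_iff_exists_Ioo_subset' hxb).1 (hright x)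
    filter_upwards [Ioo_mem_nhdsGT hxu] with x' hx' y hy
    rcases le_or_gt y x with hyx | hxy
    · exact hxS y ⟨hy.1, hyx⟩
    · exact (hxS x ⟨hax, le_rfl⟩).trans (hu ⟨hxy, hy.2.trans_lt hx'.2⟩)

theorem monotone_of_disjoint_union_eq_add {α M : Type*} [AddCommMonoid M] [Preorder M]
    [CanonicallyOrderedAdd M] {ν : Set α → M}
    (hν : ∀ S T, Disjoint S T → ν (S ∪ T) = ν S + ν T) : Monotone ν := fun S T h => by
  rw [← union_sdiff_cancel h, hν S _ disjoint_sdiff_right]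
  exact le_self_add

theorem monotone_add_Iic {α M : Type*} [ConditionallyCompleteLinearOrder α] [DenselyOrdered α]
    [TopologicalSpace α] [OrderTopology α] [AddCommMonoid M] [Preorder M]
    [CanonicallyOrderedAdd M] [IsOrderedAddMonoid M] {f : α → M} {ν : Set α → M}
    (hν : ∀ S T, Disjoint S T → ν (S ∪ T) = ν S + ν T)
    (hlow : ∀ t₀, ∀ᶠ t in 𝓝 t₀, f t₀ ≤ f t) (hjump : ∀ t₀, ∀ᶠ t in 𝓝 t₀, f t ≤ f t₀ + ν {t₀}) :
    Monotone fun t => f t + ν (Iic t) := by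
  have hmono := monotone_of_disjoint_union_eq_add hν
  refine monotone_of_eventually_le (fun t₀ => ?_) fun t₀ => ?_
  · filter_upwards [nhdsWithin_le_nhds (hjump t₀), self_mem_nhdsWithin] with t ht (htt : t < t₀)
    calc f t + ν (Iic t) ≤ f t₀ + ν {t₀} + ν (Iic t) := add_le_add_left ht _
      _ = f t₀ + ν ({t₀} ∪ Iic t) := by rw [add_assoc, hν _ _ (by simpa using htt)]
      _ ≤ f t₀ + ν (Iic t₀) := by
        gcongr
        exact hmono (union_subset (by simp) (Iic_subset_Iic.2 htt.le))
  · filter_upwards [nhdsWithin_le_nhds (hlow t₀), self_mem_nhdsWithin] with t ht (htt : t₀ < t)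
    exact add_le_add ht (hmono (Iic_subset_Iic.2 htt.le))

end LocallyMonotone

section Rank

theorem natTrailingDegree_charpoly_add_rank {𝕜 ι : Type*} [RCLike 𝕜] [Fintype ι] [DecidableEq ι]
    {A : Matrix ι ι 𝕜} (hA : A.IsHermitian) :
    A.charpoly.natTrailingDegree + A.rank = Fintype.card ι := by
  have hzero : A.charpoly.natTrailingDegree = Fintype.card {i // hA.eigenvalues i = 0} := by
    rw [← Polynomial.rootMultiplicity_eq_natTrailingDegree', ← Polynomial.count_roots,
      hA.roots_charpoly_eq_eigenvalues, Multiset.count_map, Fintype.card_subtype]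
    simp only [Function.comp_apply, eq_comm (a := (0 : 𝕜)), RCLike.ofReal_eq_zero]
    rfl
  rw [hzero, hA.rank_eq_card_non_zero_eigs, Fintype.card_subtype_compl]
  exact Nat.add_sub_cancel' (Fintype.card_subtype_le _)

variable {A B : Matrix (Fin n) (Fin n) ℂ}

theorem nPos_add_nNeg (hA : A.IsHermitian) : nPos hA + nNeg hA = A.rank := by
  rw [hA.rank_eq_card_non_zero_eigs, Fintype.card_subtype, nPos, nNeg,
    ← Finset.card_union_of_disjoint
      (Finset.disjoint_filter.2 fun i _ hpos => hpos.le.not_gt), ← Finset.filter_or]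
  simp only [ne_iff_lt_or_gt, or_comm]

theorem isHermitian_pencil (hA : A.IsHermitian) (hB : B.IsHermitian) (t : ℝ) :
    (A - (t : ℂ) • B).IsHermitian :=
  hA.sub (hB.smul (Complex.conj_ofReal t))

end Rank

section Multiplicity

variable {A B : Matrix (Fin n) (Fin n) ℂ}

/-- The number of identically vanishing eigenvalue functions of `t ↦ A - t B`, read off as the
order of vanishing at `x = 0` of `det (x I - (A - t B))` over `ℂ[t]`. -/
noncomputable def defect (A B : Matrix (Fin n) (Fin n) ℂ) : ℕ :=
  (polyPencil A B).charpoly.natTrailingDegree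

theorem eigenfunctionProd_ne_zero (A B : Matrix (Fin n) (Fin n) ℂ) : eigenfunctionProd A B ≠ 0 :=
  mt Polynomial.trailingCoeff_eq_zero.1 (Matrix.charpoly_monic _).ne_zero

theorem eval_eigenfunctionProd (A B : Matrix (Fin n) (Fin n) ℂ) (z : ℂ) :
    (eigenfunctionProd A B).eval z = (A - z • B).charpoly.coeff (defect A B) :=
  eval_coeff_charpoly A B z _

theorem defect_le_natTrailingDegree (A B : Matrix (Fin n) (Fin n) ℂ) (z : ℂ) :
    defect A B ≤ (A - z • B).charpoly.natTrailingDegree :=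
  Polynomial.le_natTrailingDegree (Matrix.charpoly_monic _).ne_zero fun j hj => by
    rw [← eval_coeff_charpoly, Polynomial.coeff_eq_zero_of_lt_natTrailingDegree hj,
      Polynomial.eval_zero]

theorem natTrailingDegree_eq_defect_iff {z : ℂ} :
    (A - z • B).charpoly.natTrailingDegree = defect A B ↔ (eigenfunctionProd A B).eval z ≠ 0 := by
  rw [eval_eigenfunctionProd]
  refine ⟨fun h => ?_, fun h => ?_⟩
  · rw [← h]
    exact mt Polynomial.trailingCoeff_eq_zero.1 (Matrix.charpoly_monic _).ne_zero
  · exact (Polynomial.natTrailingDegree_le_of_ne_zero h).antisymm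
      (defect_le_natTrailingDegree A B z)

theorem defect_add_rank_le (hA : A.IsHermitian) (hB : B.IsHermitian) (t : ℝ) :
    defect A B + (A - (t : ℂ) • B).rank ≤ n := by
  have h := natTrailingDegree_charpoly_add_rank (isHermitian_pencil hA hB t)
  rw [Fintype.card_fin] at h
  linarith [defect_le_natTrailingDegree A B t]

theorem defect_add_rank_eq_iff (hA : A.IsHermitian) (hB : B.IsHermitian) {t : ℝ} :
    defect A B + (A - (t : ℂ) • B).rank = n ↔ (eigenfunctionProd A B).eval (t : ℂ) ≠ 0 := by
  have h := natTrailingDegree_charpoly_add_rank (isHermitian_pencil hA hB t)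
  rw [Fintype.card_fin] at h
  rw [← natTrailingDegree_eq_defect_iff]
  omega

theorem le_defect_add_rank_add_rootMultiplicity (A B : Matrix (Fin n) (Fin n) ℂ) (z : ℂ) :
    n ≤ defect A B + (A - z • B).rank + (eigenfunctionProd A B).rootMultiplicity z := by
  have hshift : polyPencil A B = (A - z • B).map Polynomial.C +
      (Polynomial.X - Polynomial.C z) • -B.map Polynomial.C := by
    ext1 i j
    simp only [polyPencil, Matrix.sub_apply, Matrix.add_apply, Matrix.neg_apply, Matrix.smul_apply,
      Matrix.map_apply, smul_eq_mul, map_sub, map_mul]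
    ring
  have hdvd := pow_dvd_coeff_charpoly_map_add_smul Polynomial.C (A - z • B)
    (Polynomial.X - Polynomial.C z) (-B.map Polynomial.C) (defect A B)
  rw [← hshift, Fintype.card_fin] at hdvd
  have hle := (Polynomial.le_rootMultiplicity_iff (eigenfunctionProd_ne_zero A B)).2 hdvd
  omega

theorem rank_pencil_le_normalRank (A B : Matrix (Fin n) (Fin n) ℂ) (z : ℂ) :
    (A - z • B).rank ≤ normalRank A B :=
  le_ciSup (f := fun z => (pencilAt A B z).rank)
    ⟨n, Set.forall_mem_range.2 fun z => (pencilAt A B z).rank_le_width⟩ (z : OnePoint ℂ)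

/-- The real zeros of the product of the eigenvalue functions that are not identically zero. -/
noncomputable def realRoots (A B : Matrix (Fin n) (Fin n) ℂ) : Finset ℝ :=
  (eigenfunctionProd A B).roots.toFinset.preimage _ Complex.ofReal_injective.injOn

theorem mem_realRoots {t : ℝ} : t ∈ realRoots A B ↔ (eigenfunctionProd A B).eval (t : ℂ) = 0 := by
  simp [realRoots, eigenfunctionProd_ne_zero]

theorem algMult_eq_zero_of_notMem {t : ℝ} (ht : t ∉ realRoots A B) : algMult A B t = 0 :=
  Polynomial.rootMultiplicity_eq_zero (mt mem_realRoots.2 ht)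

theorem isEigenvalue_of_mem_realRoots (hA : A.IsHermitian) (hB : B.IsHermitian) {t : ℝ}
    (ht : t ∈ realRoots A B) : IsEigenvalue A B (t : ℂ) := by
  obtain ⟨s, hs⟩ := Infinite.exists_notMem_finset (realRoots A B)
  refine lt_of_lt_of_le ?_ (rank_pencil_le_normalRank A B s)
  have hs' := (defect_add_rank_eq_iff hA hB).2 (mt mem_realRoots.2 hs)
  have ht' := mt (defect_add_rank_eq_iff hA hB).1 (not_not.2 (mem_realRoots.1 ht))
  have hle := defect_add_rank_le hA hB t
  change (A - (t : ℂ) • B).rank < _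
  omega

end Multiplicity

section Count

variable {A B : Matrix (Fin n) (Fin n) ℂ}

open scoped Classical in
theorem countIn_eq_sum (hA : A.IsHermitian) (hB : B.IsHermitian) (S : Set ℝ) :
    countIn A B S = ∑ t ∈ realRoots A B with t ∈ S, algMult A B t := by
  have hterm : ∀ t, t ∉ realRoots A B →
      (if t ∈ S ∧ IsEigenvalue A B (t : ℂ) then algMult A B t else 0) = 0 := fun t ht => by
    rw [algMult_eq_zero_of_notMem ht, ite_self]
  rw [countIn, finsum_eq_sum_of_support_subset (s := realRoots A B), Finset.sum_filter]
  · refine Finset.sum_congr rfl fun t ht => ?_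
    simp only [isEigenvalue_of_mem_realRoots hA hB ht, and_true]
  · exact fun t ht => by_contra fun h => ht (hterm t h)

theorem countIn_union (hA : A.IsHermitian) (hB : B.IsHermitian) {S T : Set ℝ}
    (h : Disjoint S T) : countIn A B (S ∪ T) = countIn A B S + countIn A B T := by
  classical
  simp only [countIn_eq_sum hA hB, Set.mem_union, Finset.filter_or]
  exact Finset.sum_union
    (Finset.disjoint_filter.2 fun t _ hS hT => Set.disjoint_left.1 h hS hT)

theorem countIn_mono (hA : A.IsHermitian) (hB : B.IsHermitian) : Monotone (countIn A B) :=
  monotone_of_disjoint_union_eq_add fun _ _ => countIn_union hA hB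

theorem countIn_singleton (hA : A.IsHermitian) (hB : B.IsHermitian) (t : ℝ) :
    countIn A B {t} = algMult A B t := by
  classical
  simp only [countIn_eq_sum hA hB, Set.mem_singleton_iff, Finset.sum_filter, Finset.sum_ite_eq']
  exact ite_eq_left_iff.2 fun ht => (algMult_eq_zero_of_notMem ht).symm

theorem pencilPos_add_pencilNeg_add_algMult (hA : A.IsHermitian) (hB : B.IsHermitian) :
    pencilPos A B + pencilNeg A B + algMult A B 0 = pencilReal A B := by
  rw [pencilPos, pencilNeg, pencilReal, ← countIn_singleton hA hB,
    ← countIn_union hA hB Set.Ioi_disjoint_Iio_same, Set.union_comm, Set.Iio_union_Ioi,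
    ← countIn_union hA hB disjoint_compl_left, Set.compl_union_self]

theorem pencilReal_add_defect_le (hA : A.IsHermitian) (hB : B.IsHermitian) :
    pencilReal A B + defect A B ≤ n := by
  classical
  have hdegree : (eigenfunctionProd A B).natDegree ≤ n - defect A B :=
    (natDegree_coeff_charpoly_le A B (defect A B)).trans_eq (by rw [Fintype.card_fin])
  have hdefect : defect A B ≤ n := by
    linarith [defect_add_rank_le hA hB 0]
  have hroots : pencilReal A B ≤ (eigenfunctionProd A B).roots.card := by
    simp only [pencilReal, countIn_eq_sum hA hB, Set.mem_univ, Finset.filter_true, realRoots,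
      algMult, ← Polynomial.count_roots]
    rw [← Multiset.toFinset_sum_count_eq, Finset.sum_preimage' _ _ _
      fun z => (eigenfunctionProd A B).roots.count z]
    exact Finset.sum_le_sum_of_subset (Finset.filter_subset _ _)
  have hcard := (eigenfunctionProd A B).card_roots'
  omega

end Count

section PositiveSubspaces

open Matrix

variable {ι 𝕜 E : Type*} [Fintype ι] [RCLike 𝕜] [AddCommGroup E] [Module 𝕜 E]

theorem finrank_le_card_pos (b : Module.Basis ι 𝕜 E) (c : ι → ℝ) {V : Submodule 𝕜 E}
    (hV : ∀ x ∈ V, x ≠ 0 → 0 < ∑ i, c i * ‖b.repr x i‖ ^ 2) :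
    Module.finrank 𝕜 V ≤ Fintype.card {i // 0 < c i} := by
  let f : V →ₗ[𝕜] ({i // 0 < c i} → 𝕜) := LinearMap.pi fun i => b.coord i ∘ₗ V.subtype
  have hf : Function.Injective f := by
    refine (injective_iff_map_eq_zero f).2 fun x hx => by_contra fun hne => ?_
    refine (hV x x.2 (by simpa using hne)).not_ge (Finset.sum_nonpos fun i _ => ?_)
    by_cases hi : 0 < c i
    · have hxi : b.repr x i = 0 := congrFun hx ⟨i, hi⟩
      simp [hxi]
    · exact mul_nonpos_of_nonpos_of_nonneg (not_lt.1 hi) (sq_nonneg _)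
  simpa using LinearMap.finrank_le_finrank_of_injective hf

theorem exists_finrank_eq_card_pos (b : Module.Basis ι 𝕜 E) (c : ι → ℝ) :
    ∃ V : Submodule 𝕜 E, Module.finrank 𝕜 V = Fintype.card {i // 0 < c i} ∧
      ∀ x ∈ V, x ≠ 0 → 0 < ∑ i, c i * ‖b.repr x i‖ ^ 2 := by
  refine ⟨Submodule.span 𝕜 (Set.range fun i : {i // 0 < c i} => b i), ?_, fun x hx h0 => ?_⟩
  · exact finrank_span_eq_card (b.linearIndependent.comp _ Subtype.val_injective)
  have hsupp : ∀ i, b.repr x i ≠ 0 → 0 < c i := fun i hi => by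
    rw [Set.range_comp' b, Subtype.range_coe_subtype, b.mem_span_image] at hx
    exact hx (Finsupp.mem_support_iff.2 hi)
  obtain ⟨j, hj⟩ := Finsupp.ne_iff.1 (b.repr.map_ne_zero_iff.2 h0)
  refine Finset.sum_pos' (fun i _ => ?_) ⟨j, Finset.mem_univ j, ?_⟩
  · rcases eq_or_ne (b.repr x i) 0 with hi | hi
    · simp [hi]
    · exact mul_nonneg (hsupp i hi).le (sq_nonneg _)
  · exact mul_pos (hsupp j hj) (pow_pos (norm_pos_iff.2 hj) 2)

/-- The Hermitian form `x* A x`, as a real number. -/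
def form (A : Matrix ι ι 𝕜) (x : ι → 𝕜) : ℝ := RCLike.re (star x ⬝ᵥ A *ᵥ x)

theorem form_smul_right (A : Matrix ι ι 𝕜) (r : 𝕜) (x : ι → 𝕜) :
    form A (r • x) = ‖r‖ ^ 2 * form A x := by
  rw [form, mulVec_smul, dotProduct_smul, star_smul, smul_dotProduct, smul_smul,
    smul_eq_mul, ← starRingEnd_apply, RCLike.mul_conj, ← RCLike.ofReal_pow,
    RCLike.re_ofReal_mul, form]

theorem form_ofReal_smul_left (r : ℝ) (A : Matrix ι ι 𝕜) (x : ι → 𝕜) :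
    form ((r : 𝕜) • A) x = r * form A x := by
  rw [form, smul_mulVec, dotProduct_smul, smul_eq_mul, RCLike.re_ofReal_mul, form]

theorem form_neg (A : Matrix ι ι 𝕜) (x : ι → 𝕜) : form (-A) x = -form A x := by
  rw [form, neg_mulVec, dotProduct_neg, map_neg, form]

theorem continuous_form : Continuous fun p : Matrix ι ι 𝕜 × (ι → 𝕜) => form p.1 p.2 := by
  unfold form
  fun_prop

theorem exists_basis_form_eq_sum [DecidableEq ι] {A : Matrix ι ι 𝕜} (hA : A.IsHermitian) :
    ∃ b : Module.Basis ι 𝕜 (ι → 𝕜),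
      ∀ x, form A x = ∑ i, hA.eigenvalues i * ‖b.repr x i‖ ^ 2 := by
  let U := hA.eigenvectorUnitary
  refine ⟨Module.Basis.ofEquivFun (UnitaryGroup.toLinearEquiv (star U)), fun x => ?_⟩
  set y : ι → 𝕜 := (star U : Matrix ι ι 𝕜) *ᵥ x
  have hdiag : star x ⬝ᵥ A *ᵥ x =
      star y ⬝ᵥ diagonal (RCLike.ofReal ∘ hA.eigenvalues) *ᵥ y := by
    conv_lhs => rw [hA.spectral_theorem]
    rw [Unitary.conjStarAlgAut_apply, ← mulVec_mulVec, ← mulVec_mulVec, dotProduct_mulVec,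
      star_mulVec, star_eq_conjTranspose, conjTranspose_conjTranspose]
    rfl
  rw [form, hdiag, dotProduct, map_sum]
  refine Finset.sum_congr rfl fun i _ => ?_
  rw [mulVec_diagonal, Pi.star_apply, mul_left_comm, Function.comp_apply, RCLike.re_ofReal_mul,
    ← starRingEnd_apply, RCLike.conj_mul, ← RCLike.ofReal_pow, RCLike.ofReal_re]
  rfl

end PositiveSubspaces

section Inertia

open Filter Topology

variable {A : Matrix (Fin n) (Fin n) ℂ}

theorem isGreatest_nPos (hA : A.IsHermitian) :
    IsGreatest {d | ∃ V : Submodule ℂ (Fin n → ℂ), Module.finrank ℂ V = d ∧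
      ∀ x ∈ V, x ≠ 0 → 0 < form A x} (nPos hA) := by
  obtain ⟨b, hb⟩ := exists_basis_form_eq_sum hA
  rw [nPos, ← Fintype.card_subtype]
  simp only [hb]
  refine ⟨exists_finrank_eq_card_pos b _, ?_⟩
  rintro _ ⟨V, rfl, hV⟩
  exact finrank_le_card_pos b _ hV

theorem isGreatest_nNeg (hA : A.IsHermitian) :
    IsGreatest {d | ∃ V : Submodule ℂ (Fin n → ℂ), Module.finrank ℂ V = d ∧
      ∀ x ∈ V, x ≠ 0 → 0 < form (-A) x} (nNeg hA) := by
  obtain ⟨b, hb⟩ := exists_basis_form_eq_sum hA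
  simp only [nNeg, ← neg_pos (a := hA.eigenvalues _), ← Fintype.card_subtype, form_neg, hb,
    ← Finset.sum_neg_distrib, ← neg_mul]
  refine ⟨exists_finrank_eq_card_pos b (-hA.eigenvalues), ?_⟩
  rintro _ ⟨V, rfl, hV⟩
  exact finrank_le_card_pos b (-hA.eigenvalues) hV

theorem nPos_neg (hA : A.IsHermitian) : nPos hA.neg = nNeg hA :=
  (isGreatest_nPos hA.neg).unique (isGreatest_nNeg hA)

theorem eventually_nPos_le (hA : A.IsHermitian) :
    ∀ᶠ A' in 𝓝 A, ∀ hA' : A'.IsHermitian, nPos hA ≤ nPos hA' := by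
  obtain ⟨V, hV, hpos⟩ := (isGreatest_nPos hA).1
  have hcompact : IsCompact ((V : Set (Fin n → ℂ)) ∩ Metric.sphere 0 1) :=
    (isCompact_sphere 0 1).inter_left V.closed_of_finiteDimensional
  have hunit : ∀ᶠ A' in 𝓝 A, ∀ x ∈ (V : Set (Fin n → ℂ)) ∩ Metric.sphere 0 1, 0 < form A' x :=
    hcompact.eventually_forall_of_forall_eventually fun x hx =>
      continuous_form.continuousAt.eventually_const_lt
        (hpos x hx.1 (ne_zero_of_mem_unit_sphere ⟨x, hx.2⟩))
  filter_upwards [hunit] with A' hA'unit hA'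
  refine (isGreatest_nPos hA').2 ⟨V, hV, fun x hx h0 => ?_⟩
  have hscaled := hA'unit (((‖x‖⁻¹ : ℝ) : ℂ) • x) ⟨V.smul_mem _ hx, by simp [norm_smul, h0]⟩
  rw [form_smul_right] at hscaled
  exact pos_of_mul_pos_right hscaled (sq_nonneg _)

theorem eventually_nNeg_le (hA : A.IsHermitian) :
    ∀ᶠ A' in 𝓝 A, ∀ hA' : A'.IsHermitian, nNeg hA ≤ nNeg hA' := by
  filter_upwards [continuous_neg.continuousAt.eventually (eventually_nPos_le hA.neg)] with A' h hA'
  exact nPos_neg hA ▸ nPos_neg hA' ▸ h hA'.neg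

theorem nPos_of_eq_smul {A' : Matrix (Fin n) (Fin n) ℂ} (hA : A.IsHermitian)
    (hA' : A'.IsHermitian) {r : ℝ} (hr : 0 < r) (h : A' = (r : ℂ) • A) : nPos hA' = nPos hA := by
  refine (isGreatest_nPos hA').unique ?_
  have hform : ∀ x, 0 < form A' x ↔ 0 < form A x := fun x => by
    rw [h, ← RCLike.ofReal_eq_complex_ofReal, form_ofReal_smul_left, mul_pos_iff_of_pos_left hr]
  simpa only [hform] using isGreatest_nPos hA

end Inertia

section Pencil

open Set Filter Topology

variable {A B : Matrix (Fin n) (Fin n) ℂ} (hA : A.IsHermitian) (hB : B.IsHermitian)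

include hA hB

theorem eventually_nPos_pencil_le (t₀ : ℝ) : ∀ᶠ t in 𝓝 t₀,
    nPos (isHermitian_pencil hA hB t₀) ≤ nPos (isHermitian_pencil hA hB t) := by
  have hcont : Continuous fun t : ℝ => A - (t : ℂ) • B := by fun_prop
  filter_upwards [hcont.continuousAt.eventually
    (eventually_nPos_le (isHermitian_pencil hA hB t₀))] with t ht using ht _

theorem eventually_nNeg_pencil_le (t₀ : ℝ) : ∀ᶠ t in 𝓝 t₀,
    nNeg (isHermitian_pencil hA hB t₀) ≤ nNeg (isHermitian_pencil hA hB t) := by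
  have hcont : Continuous fun t : ℝ => A - (t : ℂ) • B := by fun_prop
  filter_upwards [hcont.continuousAt.eventually
    (eventually_nNeg_le (isHermitian_pencil hA hB t₀))] with t ht using ht _

theorem nPos_add_nNeg_pencil_le (t : ℝ) :
    nPos (isHermitian_pencil hA hB t) + nNeg (isHermitian_pencil hA hB t) + defect A B ≤ n := by
  rw [nPos_add_nNeg, add_comm]
  exact defect_add_rank_le hA hB t

theorem le_nPos_add_nNeg_pencil (t : ℝ) :
    n ≤ nPos (isHermitian_pencil hA hB t) + nNeg (isHermitian_pencil hA hB t) + defect A B +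
      algMult A B t := by
  rw [nPos_add_nNeg, add_comm (Matrix.rank _)]
  exact le_defect_add_rank_add_rootMultiplicity A B t

theorem monotone_nPos_add_countIn_Iic :
    Monotone fun t => nPos (isHermitian_pencil hA hB t) + countIn A B (Iic t) := by
  refine monotone_add_Iic (fun _ _ => countIn_union hA hB) (eventually_nPos_pencil_le hA hB)
    fun t₀ => ?_
  filter_upwards [eventually_nNeg_pencil_le hA hB t₀] with t ht
  rw [countIn_singleton hA hB]
  linarith [nPos_add_nNeg_pencil_le hA hB t, le_nPos_add_nNeg_pencil hA hB t₀]

theorem antitone_nNeg_add_countIn_Ici :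
    Antitone fun t => nNeg (isHermitian_pencil hA hB t) + countIn A B (Ici t) := by
  have hjump (t₀ : ℝ) : ∀ᶠ t in 𝓝 t₀, nNeg (isHermitian_pencil hA hB t) ≤
      nNeg (isHermitian_pencil hA hB t₀) + countIn A B {t₀} := by
    filter_upwards [eventually_nPos_pencil_le hA hB t₀] with t ht
    rw [countIn_singleton hA hB]
    linarith [nPos_add_nNeg_pencil_le hA hB t, le_nPos_add_nNeg_pencil hA hB t₀]
  exact (monotone_add_Iic (α := ℝᵒᵈ) (fun _ _ => countIn_union hA hB)
    (eventually_nNeg_pencil_le hA hB) hjump).dual_left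

theorem exists_nPos_le_nNeg_pencil_and_nPos_pencil_neg :
    ∃ T > 0, nPos hB ≤ nNeg (isHermitian_pencil hA hB T) ∧
      nPos hB ≤ nPos (isHermitian_pencil hA hB (-T)) := by
  have hzero : ∀ᶠ s in 𝓝 (0 : ℝ), nPos hB ≤ nPos (isHermitian_pencil hB hA s) := by
    simpa using eventually_nPos_pencil_le hB hA 0
  have hinfty := (tendsto_inv_atTop_zero.eventually hzero).and
    ((tendsto_inv_atBot_zero.comp tendsto_neg_atTop_atBot).eventually hzero)
  obtain ⟨T, ⟨hT, hT'⟩, hpos⟩ := (hinfty.and (eventually_gt_atTop 0)).exists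
  have hreverse {t : ℝ} (ht : t ≠ 0) :
      A - (t : ℂ) • B = (-t : ℂ) • (B - ((t⁻¹ : ℝ) : ℂ) • A) := by
    have ht' : (t : ℂ) ≠ 0 := Complex.ofReal_ne_zero.2 ht
    rw [smul_sub, smul_smul, Complex.ofReal_inv, neg_mul, mul_inv_cancel₀ ht']
    module
  refine ⟨T, hpos, hT.trans_eq ?_, hT'.trans_eq ?_⟩
  · rw [← nPos_neg]
    refine (nPos_of_eq_smul _ _ hpos ?_).symm
    rw [hreverse hpos.ne', neg_smul, neg_neg]
  · refine (nPos_of_eq_smul _ _ hpos ?_).symm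
    rw [hreverse (neg_ne_zero.2 hpos.ne'), Complex.ofReal_neg, neg_neg]
    rfl

theorem nPos_add_nPos_le_pencilPos_add : nPos hA + nPos hB ≤ pencilPos A B + n := by
  obtain ⟨T, hT, hneg, -⟩ := exists_nPos_le_nNeg_pencil_and_nPos_pencil_neg hA hB
  have hmono : nPos hA + countIn A B (Iic 0) ≤
      nPos (isHermitian_pencil hA hB T) + countIn A B (Iic T) := by
    simpa using monotone_nPos_add_countIn_Iic hA hB hT.le
  have hsplit : countIn A B (Iic T) ≤ countIn A B (Iic 0) + pencilPos A B := by
    rw [pencilPos, ← countIn_union hA hB (Iic_disjoint_Ioi le_rfl), Iic_union_Ioi]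
    exact countIn_mono hA hB (subset_univ _)
  linarith [nPos_add_nNeg_pencil_le hA hB T]

theorem nNeg_add_nPos_le_pencilNeg_add : nNeg hA + nPos hB ≤ pencilNeg A B + n := by
  obtain ⟨T, hT, -, hpos⟩ := exists_nPos_le_nNeg_pencil_and_nPos_pencil_neg hA hB
  have hanti : nNeg hA + countIn A B (Ici 0) ≤
      nNeg (isHermitian_pencil hA hB (-T)) + countIn A B (Ici (-T)) := by
    simpa using antitone_nNeg_add_countIn_Ici hA hB (neg_nonpos.2 hT.le)
  have hsplit : countIn A B (Ici (-T)) ≤ pencilNeg A B + countIn A B (Ici 0) := by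
    rw [pencilNeg, ← countIn_union hA hB (Iio_disjoint_Ici le_rfl), Iio_union_Ici]
    exact countIn_mono hA hB (subset_univ _)
  linarith [nPos_add_nNeg_pencil_le hA hB (-T)]

theorem two_mul_nPos_le_pencilReal_add : 2 * nPos hB ≤ pencilReal A B + n := by
  obtain ⟨T, hT, hneg, hpos⟩ := exists_nPos_le_nNeg_pencil_and_nPos_pencil_neg hA hB
  have hmono : nPos (isHermitian_pencil hA hB (-T)) + countIn A B (Iic (-T)) ≤
      nPos (isHermitian_pencil hA hB T) + countIn A B (Iic T) :=
    monotone_nPos_add_countIn_Iic hA hB (neg_le_self hT.le)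
  have hreal : countIn A B (Iic T) ≤ pencilReal A B := countIn_mono hA hB (subset_univ _)
  linarith [nPos_add_nNeg_pencil_le hA hB T]

theorem le_nPos_add_nNeg_add_defect_add_algMult :
    n ≤ nPos hA + nNeg hA + defect A B + algMult A B 0 := by
  simpa using le_nPos_add_nNeg_pencil hA hB 0

end Pencil

end HermitianPencil

theorem corollary4p2_general (n k : ℕ) (A B : Matrix (Fin n) (Fin n) ℂ)
    (hA : A.IsHermitian) (hB : B.IsHermitian) (hk : n ≤ HermitianPencil.nPos hB + k) :
    ((HermitianPencil.nPos hA : ℤ) - k ≤ HermitianPencil.pencilPos A B ∧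
      (HermitianPencil.pencilPos A B : ℤ) ≤ HermitianPencil.nPos hA + k) ∧
    ((HermitianPencil.nNeg hA : ℤ) - k ≤ HermitianPencil.pencilNeg A B ∧
      (HermitianPencil.pencilNeg A B : ℤ) ≤ HermitianPencil.nNeg hA + k) ∧
    ((n : ℤ) - 2 * k ≤ HermitianPencil.pencilReal A B ∧
      (HermitianPencil.pencilReal A B : ℤ) ≤ n) := by
  have hpos := HermitianPencil.nPos_add_nPos_le_pencilPos_add hA hB
  have hneg := HermitianPencil.nNeg_add_nPos_le_pencilNeg_add hA hB
  have hreal := HermitianPencil.two_mul_nPos_le_pencilReal_add hA hB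
  have hzero := HermitianPencil.le_nPos_add_nNeg_add_defect_add_algMult hA hB
  have hsplit := HermitianPencil.pencilPos_add_pencilNeg_add_algMult hA hB
  have htotal := HermitianPencil.pencilReal_add_defect_le hA hB
  omega

theorem corollary4p2 (n k : ℕ) (A B : Matrix (Fin n) (Fin n) ℂ)
    (hA : A.IsHermitian) (hB : B.IsHermitian)
    (hk : (HermitianPencil.nPos hB : ℤ) = (n : ℤ) - (k : ℤ))
    (hsmall : |(HermitianPencil.nNeg hA : ℤ) - (HermitianPencil.nPos hA : ℤ)| ≤
      (n : ℤ) - (k : ℤ)) :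
    ((HermitianPencil.nPos hA : ℤ) - k ≤ HermitianPencil.pencilPos A B ∧
      (HermitianPencil.pencilPos A B : ℤ) ≤ HermitianPencil.nPos hA + k) ∧
    ((HermitianPencil.nNeg hA : ℤ) - k ≤ HermitianPencil.pencilNeg A B ∧
      (HermitianPencil.pencilNeg A B : ℤ) ≤ HermitianPencil.nNeg hA + k) ∧
    ((n : ℤ) - 2 * k ≤ HermitianPencil.pencilReal A B ∧
      (HermitianPencil.pencilReal A B : ℤ) ≤ n) :=
  corollary4p2_general n k A B hA hB (by omega)
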